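/- Let $X_1,X_2,\ldots$ be i.i.d. random elements of a measurable space $\mathcal X$ and let $h:\mathcal X^2\to\mathbb R$ be a symmetric measurable kernel with $\mathbb E|h(X_1,X_2)|^4<\infty$. Put $\theta=\mathbb E\,h(X_1,X_2)$, $h_1(x)=\mathbb E\{h(x,X_2)\}-\theta$, $\sigma^2=\mathrm{Var}\{h_1(X_1)\}$, and for $n\ge 2$ $$U_n=\binom n2^{-1}\sum_{1\le i<j\le n}h(X_i,X_j),\qquad \widehat\sigma_n^2=\frac1n\sum_{i=1}^n\Bigl\{\frac1{n-1}\sum_{1\le j\le n,\ j\ne i}h(X_i,X_j)\Bigr\}^2-U_n^2 .$$ Then $\widehat\sigma_n^2$ is strongly consistent, that is, $\widehat\sigma_n^2\to\sigma^2$ almost surely, with the rate $$\bigl|\widehat\sigma_n^2-\sigma^2\bigr|=\mathcal O_{a.s.}\bigl(\sqrt{\log\log n/n}\bigr),$$ meaning that, almost surely, there is a finite (possibly random) constant $C$ with $|\widehat\sigma_n^2-\sigma^2|\le C\sqrt{\log\log n/n}$ for all sufficiently large $n$. -/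

import Mathlib

open MeasureTheory ProbabilityTheory Filter Asymptotics Topology

noncomputable section

namespace JackknifeU

/-- The parameter `θ = E h(X₁, X₂)`. The sequence is indexed from `0`, so that the first two
observations are `X 0` and `X 1`. -/
def theta {Ω 𝓧 : Type*} [MeasurableSpace Ω] (P : Measure Ω) (X : ℕ → Ω → 𝓧)
    (h : 𝓧 → 𝓧 → ℝ) : ℝ :=
  ∫ ω, h (X 0 ω) (X 1 ω) ∂P

/-- The first-order projection `h₁(x) = E h(x, X₂) - θ`. -/
def firstProj {Ω 𝓧 : Type*} [MeasurableSpace Ω] (P : Measure Ω) (X : ℕ → Ω → 𝓧)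
    (h : 𝓧 → 𝓧 → ℝ) (x : 𝓧) : ℝ :=
  (∫ ω, h x (X 1 ω) ∂P) - theta P X h

/-- `σ² = Var h₁(X₁)`. -/
def sigmaSq {Ω 𝓧 : Type*} [MeasurableSpace Ω] (P : Measure Ω) (X : ℕ → Ω → 𝓧)
    (h : 𝓧 → 𝓧 → ℝ) : ℝ :=
  variance (fun ω => firstProj P X h (X 0 ω)) P

/-- The U-statistic of degree two of the first `n` terms of the data sequence `x`: the average of
`h (x i) (x j)` over the pairs `i < j < n`. -/
def uStat {𝓧 : Type*} (h : 𝓧 → 𝓧 → ℝ) (x : ℕ → 𝓧) (n : ℕ) : ℝ :=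
  ((n.choose 2 : ℕ) : ℝ)⁻¹ * ∑ j ∈ Finset.range n, ∑ i ∈ Finset.range j, h (x i) (x j)

/-- The jackknife variance estimator computed from the first `n` terms of the data sequence `x`. -/
def jackknifeVar {𝓧 : Type*} (h : 𝓧 → 𝓧 → ℝ) (x : ℕ → 𝓧) (n : ℕ) : ℝ :=
  (1 / (n : ℝ)) * ∑ i ∈ Finset.range n,
      ((1 / ((n : ℝ) - 1)) * ∑ j ∈ (Finset.range n).erase i, h (x i) (x j)) ^ 2
    - uStat h x n ^ 2

end JackknifeU

end

/-!
Write `a x = ∫ h x y ∂μ` and `k x y = h x y - a x`, where `μ` is the law of the observations. Since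
the mean of `h (X i) (X j)` over `j ≠ i` is `a (X i)` plus the mean of `k (X i) (X j)`, squaring and
averaging over `i` splits `jackknifeVar + uStat ^ 2` into the mean of `a (X i) ^ 2`, twice the mean
of the kernel `a x * k x y` over pairs, and the mean of the squared row means of `k`.

The first term obeys the law of the iterated logarithm, by truncation and an exponential maximal
inequality. Sums over pairs, such as the second term and `uStat`, reduce to sums of independent
variables and to sums of kernels that are degenerate in both arguments, which are `O(n ^ (5 / 4))`
by a Rademacher–Menshov argument along `n = 2 ^ k`. The same argument, applied to each row
separately, shows that the squared row sums of `k` add up to `O(n ^ (5 / 2))`. After normalization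
both bounds are of smaller order than `√(log log n / n)`.
-/

noncomputable section

namespace JackknifeU

section MaximalInequality

variable {Ω : Type*} [MeasurableSpace Ω] {P : Measure Ω}

lemma integrable_prod_range_succ {s : ℕ → Ω → ℝ} (hm : ∀ i, StronglyMeasurable (s i))
    (hind : iIndepFun s P) (hint : ∀ i, Integrable (s i) P) (n : ℕ) :
    Integrable (∏ i ∈ Finset.range (n + 1), s i) P := by
  induction n with
  | zero => simpa using hint 0
  | succ n ih =>
    rw [Finset.prod_range_succ]
    exact (hind.indepFun_prod_range_succ (fun i => (hm i).measurable) (n + 1)).integrable_mul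
      ih (hint (n + 1))

lemma submartingale_prod_range_succ {s : ℕ → Ω → ℝ} (hm : ∀ i, StronglyMeasurable (s i))
    (hind : iIndepFun s P) (hint : ∀ i, Integrable (s i) P) (hnonneg : ∀ i, 0 ≤ s i)
    (hmean : ∀ i, 1 ≤ ∫ ω, s i ω ∂P) :
    Submartingale (fun n => ∏ i ∈ Finset.range (n + 1), s i) (Filtration.natural s hm) P := by
  have := hind.isProbabilityMeasure
  have hprod_int := integrable_prod_range_succ hm hind hint
  have hadapted : StronglyAdapted (Filtration.natural s hm)
      fun n => ∏ i ∈ Finset.range (n + 1), s i := fun n =>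
    Finset.stronglyMeasurable_prod _ fun i hi =>
      (Filtration.stronglyAdapted_natural hm i).mono
        ((Filtration.natural s hm).mono (Finset.mem_range_succ_iff.mp hi))
  refine submartingale_nat hadapted hprod_int fun n => ?_
  have hpull : P[∏ i ∈ Finset.range (n + 1 + 1), s i | Filtration.natural s hm n] =ᵐ[P]
      (∏ i ∈ Finset.range (n + 1), s i) * P[s (n + 1) | Filtration.natural s hm n] := by
    have hint_succ := hprod_int (n + 1)
    rw [Finset.prod_range_succ] at hint_succ ⊢
    exact condExp_mul_of_stronglyMeasurable_left (hadapted n) hint_succ (hint (n + 1))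
  filter_upwards [hpull, hind.condExp_natural_ae_eq_of_lt hm n.lt_succ_self] with ω h_pull h_indep
  rw [h_pull, Pi.mul_apply, h_indep, Finset.prod_apply]
  exact le_mul_of_one_le_right (Finset.prod_nonneg fun i _ => hnonneg i ω) (hmean (n + 1))

lemma mul_measure_exists_le_prod_range_succ_le {s : ℕ → Ω → ℝ}
    (hm : ∀ i, StronglyMeasurable (s i)) (hind : iIndepFun s P) (hint : ∀ i, Integrable (s i) P)
    (hnonneg : ∀ i, 0 ≤ s i) (hmean : ∀ i, 1 ≤ ∫ ω, s i ω ∂P) (c : NNReal) (N : ℕ) :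
    c * P {ω | ∃ n ≤ N, c ≤ ∏ i ∈ Finset.range (n + 1), s i ω} ≤
      ENNReal.ofReal (∏ i ∈ Finset.range (N + 1), ∫ ω, s i ω ∂P) := by
  have := hind.isProbabilityMeasure
  have hsub := submartingale_prod_range_succ hm hind hint hnonneg hmean
  have hprod_nonneg : 0 ≤ fun n => ∏ i ∈ Finset.range (n + 1), s i :=
    fun n => Finset.prod_nonneg fun i _ => hnonneg i
  have hintegral : ∫ ω, (∏ i ∈ Finset.range (N + 1), s i) ω ∂P =
      ∏ i ∈ Finset.range (N + 1), ∫ ω, s i ω ∂P := by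
    rw [← Finset.prod_coe_sort, ← Finset.prod_coe_sort _ fun i => ∫ ω, s i ω ∂P]
    exact (hind.precomp Subtype.val_injective).integral_prod_eq_prod_integral
      fun i => (hm i).aestronglyMeasurable
  rw [← hintegral]
  refine le_trans (mul_le_mul_right (measure_mono ?_) _) ((maximal_ineq hsub hprod_nonneg N).trans
    (ENNReal.ofReal_le_ofReal (setIntegral_le_integral (hsub.integrable N)
      (ae_of_all _ (hprod_nonneg N)))))
  rintro ω ⟨n, hn, hcn⟩
  rw [← Finset.prod_apply] at hcn
  exact hcn.trans (Finset.le_sup' (fun k => (∏ i ∈ Finset.range (k + 1), s i) ω)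
    (Finset.mem_range_succ_iff.mpr hn))

lemma measure_exists_le_sum_range_le {Z : ℕ → Ω → ℝ} {t a : ℝ} (hm : ∀ i, Measurable (Z i))
    (hind : iIndepFun Z P) (hint : ∀ i, Integrable (Z i) P) (hmean : ∀ i, ∫ ω, Z i ω ∂P = 0)
    (hexp : ∀ i, Integrable (fun ω => Real.exp (t * Z i ω)) P) (ht : 0 ≤ t) (ha : 0 < a)
    (N : ℕ) :
    P {ω | ∃ n ≤ N, a ≤ ∑ i ∈ Finset.range n, Z i ω} ≤
      ENNReal.ofReal ((∏ i ∈ Finset.range N, mgf (Z i) P t) / Real.exp (t * a)) := by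
  have := hind.isProbabilityMeasure
  rcases N with _ | N
  · simp [ha.not_ge]
  have hone_le : ∀ i, 1 ≤ ∫ ω, Real.exp (t * Z i ω) ∂P := fun i => by
    calc (1 : ℝ) = ∫ ω, (t * Z i ω + 1) ∂P := by
          rw [integral_add ((hint i).const_mul t) (integrable_const 1), integral_const_mul, hmean i]
          simp
      _ ≤ _ := integral_mono (((hint i).const_mul t).add (integrable_const 1)) (hexp i)
          fun ω => Real.add_one_le_exp _
  have hdoob := mul_measure_exists_le_prod_range_succ_le
    (fun i => ((hm i).const_mul t).exp.stronglyMeasurable)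
    (hind.comp (fun _ z => Real.exp (t * z)) fun _ => by fun_prop) hexp
    (fun i ω => (Real.exp_pos _).le) hone_le ⟨Real.exp (t * a), (Real.exp_pos _).le⟩ N
  rw [ENNReal.ofReal_div_of_pos (Real.exp_pos _),
    ENNReal.le_div_iff_mul_le (Or.inl (by simp [Real.exp_pos])) (Or.inl ENNReal.ofReal_ne_top),
    mul_comm, ENNReal.ofReal_eq_coe_nnreal (Real.exp_pos _).le]
  refine le_trans (mul_le_mul_right (measure_mono ?_) _) hdoob
  rintro ω ⟨_ | n, hn, han⟩
  · rw [Finset.range_zero, Finset.sum_empty] at han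
    exact absurd han ha.not_ge
  · refine ⟨n, Nat.succ_le_succ_iff.mp hn, ?_⟩
    rw [← Real.exp_sum, ← Finset.mul_sum]
    exact Real.exp_le_exp.mpr (mul_le_mul_of_nonneg_left han ht)

lemma mgf_le_exp_sq_mul {Z : Ω → ℝ} [IsProbabilityMeasure P] (hZ : AEStronglyMeasurable Z P)
    {K v t : ℝ} (ht : 0 ≤ t) (hK : ∀ ω, |Z ω| ≤ K) (htK : t * K ≤ 1)
    (hmean : ∫ ω, Z ω ∂P = 0) (hvar : ∫ ω, Z ω ^ 2 ∂P ≤ v) :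
    mgf Z P t ≤ Real.exp (t ^ 2 * v) := by
  have hZL : ∀ p, MemLp Z p P := fun p => MemLp.of_bound hZ K (ae_of_all _ hK)
  have hlin : Integrable (fun ω => 1 + t * Z ω) P :=
    (integrable_const 1).add (((hZL 1).integrable le_rfl).const_mul t)
  have hquad : Integrable (fun ω => t ^ 2 * Z ω ^ 2) P := (hZL 2).integrable_sq.const_mul _
  have hexp_le : ∀ ω, Real.exp (t * Z ω) ≤ 1 + t * Z ω + t ^ 2 * Z ω ^ 2 := fun ω => by
    have htZ : |t * Z ω| ≤ 1 := by
      rw [abs_mul, abs_of_nonneg ht]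
      exact (mul_le_mul_of_nonneg_left (hK ω) ht).trans htK
    linarith [(abs_le.mp (Real.abs_exp_sub_one_sub_id_le htZ)).2, mul_pow t (Z ω) 2]
  calc mgf Z P t ≤ ∫ ω, (1 + t * Z ω + t ^ 2 * Z ω ^ 2) ∂P :=
        integral_mono_of_nonneg (ae_of_all _ fun ω => (Real.exp_pos _).le) (hlin.add hquad)
          (ae_of_all _ hexp_le)
    _ = 1 + t ^ 2 * ∫ ω, Z ω ^ 2 ∂P := by
        rw [integral_add hlin hquad, integral_add (integrable_const 1)
          (((hZL 1).integrable le_rfl).const_mul t), integral_const_mul, integral_const_mul, hmean]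
        simp
    _ ≤ 1 + t ^ 2 * v := by gcongr
    _ ≤ Real.exp (t ^ 2 * v) := by linarith [Real.add_one_le_exp (t ^ 2 * v)]

lemma measure_exists_le_sum_range_le_exp {Z : ℕ → Ω → ℝ} {K v t a : ℝ}
    (hm : ∀ i, Measurable (Z i)) (hind : iIndepFun Z P) (ht : 0 ≤ t) (hK : ∀ i ω, |Z i ω| ≤ K)
    (htK : t * K ≤ 1) (hmean : ∀ i, ∫ ω, Z i ω ∂P = 0) (hvar : ∀ i, ∫ ω, Z i ω ^ 2 ∂P ≤ v)
    (ha : 0 < a) (N : ℕ) :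
    P {ω | ∃ n ≤ N, a ≤ ∑ i ∈ Finset.range n, Z i ω} ≤
      ENNReal.ofReal (Real.exp (N * (t ^ 2 * v) - t * a)) := by
  have := hind.isProbabilityMeasure
  have hint : ∀ i, Integrable (Z i) P := fun i =>
    Integrable.of_bound (hm i).aestronglyMeasurable K (ae_of_all _ (hK i))
  have hexp : ∀ i, Integrable (fun ω => Real.exp (t * Z i ω)) P := fun i =>
    Integrable.of_bound ((hm i).const_mul t).exp.aestronglyMeasurable (Real.exp 1)
      (ae_of_all _ fun ω => by
        rw [Real.norm_eq_abs, Real.abs_exp, Real.exp_le_exp]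
        exact (mul_le_mul_of_nonneg_left ((le_abs_self _).trans (hK i ω)) ht).trans htK)
  refine (measure_exists_le_sum_range_le hm hind hint hmean hexp ht ha N).trans
    (ENNReal.ofReal_le_ofReal ?_)
  rw [Real.exp_sub, Real.exp_nat_mul]
  gcongr
  calc ∏ i ∈ Finset.range N, mgf (Z i) P t ≤ ∏ _i ∈ Finset.range N, Real.exp (t ^ 2 * v) :=
        Finset.prod_le_prod (fun i _ => mgf_nonneg) fun i _ =>
          mgf_le_exp_sq_mul (hm i).aestronglyMeasurable ht (hK i) htK (hmean i) (hvar i)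
    _ = Real.exp (t ^ 2 * v) ^ N := by rw [Finset.prod_const, Finset.card_range]

lemma measure_exists_le_abs_sum_range_le_exp {Z : ℕ → Ω → ℝ} {K v t a : ℝ}
    (hm : ∀ i, Measurable (Z i)) (hind : iIndepFun Z P) (ht : 0 ≤ t) (hK : ∀ i ω, |Z i ω| ≤ K)
    (htK : t * K ≤ 1) (hmean : ∀ i, ∫ ω, Z i ω ∂P = 0) (hvar : ∀ i, ∫ ω, Z i ω ^ 2 ∂P ≤ v)
    (ha : 0 < a) (N : ℕ) :
    P {ω | ∃ n ≤ N, a ≤ |∑ i ∈ Finset.range n, Z i ω|} ≤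
      2 * ENNReal.ofReal (Real.exp (N * (t ^ 2 * v) - t * a)) := by
  have hupper := measure_exists_le_sum_range_le_exp hm hind ht hK htK hmean hvar ha N
  have hlower := measure_exists_le_sum_range_le_exp (Z := fun i ω => -Z i ω)
    (fun i => (hm i).neg) (hind.comp (fun _ z => -z) fun _ => measurable_neg) ht
    (fun i ω => (abs_neg _).trans_le (hK i ω)) htK
    (fun i => by rw [integral_neg, hmean, neg_zero]) (fun i => by simpa only [neg_sq] using hvar i)
    ha N
  rw [two_mul]
  refine ((measure_mono ?_).trans (measure_union_le _ _)).trans (add_le_add hupper hlower)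
  rintro ω ⟨n, hn, han⟩
  rcases le_abs.mp han with h | h
  · exact Or.inl ⟨n, hn, h⟩
  · exact Or.inr ⟨n, hn, by rwa [Finset.sum_neg_distrib]⟩

end MaximalInequality

section Rates

/-- The rate `√(log log n / n)` of the theorem. For `n ≤ 2` it has a junk value. -/
def lilRate (n : ℕ) : ℝ := √(Real.log (Real.log n) / n)

/-- The analogue of `√(n log log n)` along `n = 2 ^ k`. The shift by `3` keeps the logarithm above
`1` for every `k`. -/
def dyadicRate (k : ℕ) : ℝ := √(2 ^ k * Real.log (k + 3))

/-- The level at which summands are truncated while partial sums up to `2 ^ k` are considered. -/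
def truncLevel (k : ℕ) : ℝ := √(2 ^ k / Real.log (k + 3))

lemma tendsto_log_natCast : Tendsto (fun n : ℕ => Real.log n) atTop atTop :=
  Real.tendsto_log_atTop.comp tendsto_natCast_atTop_atTop

lemma tendsto_lilRate : Tendsto lilRate atTop (𝓝 0) := by
  have hlog_div : Tendsto (fun n : ℕ => √(Real.log n / n)) atTop (𝓝 0) := by
    simpa only [Function.comp_apply, id_eq, Real.sqrt_zero] using
      (Real.isLittleO_log_id_atTop.tendsto_div_nhds_zero.comp tendsto_natCast_atTop_atTop).sqrt
  refine squeeze_zero (fun n => Real.sqrt_nonneg _) (fun n => ?_) hlog_div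
  exact Real.sqrt_le_sqrt (div_le_div_of_nonneg_right
    (Real.log_le_self (Real.log_natCast_nonneg n)) n.cast_nonneg)

lemma isBigO_inv_sqrt_lilRate : (fun n : ℕ => (√n)⁻¹) =O[atTop] lilRate := by
  refine IsBigO.of_bound' ?_
  filter_upwards [tendsto_log_natCast.eventually_ge_atTop (Real.exp 1)] with n hn
  rw [Real.norm_of_nonneg (by positivity), lilRate, Real.norm_of_nonneg (Real.sqrt_nonneg _),
    ← Real.sqrt_inv, ← one_div]
  refine Real.sqrt_le_sqrt (div_le_div_of_nonneg_right ?_ n.cast_nonneg)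
  rwa [Real.le_log_iff_exp_le ((Real.exp_pos 1).trans_le hn)]

lemma natCast_mul_lilRate (n : ℕ) : n * lilRate n = √(n * Real.log (Real.log n)) := by
  rcases n.eq_zero_or_pos with rfl | hn
  · simp
  · have hn' : (0 : ℝ) < n := Nat.cast_pos.mpr hn
    rw [lilRate, ← Real.sqrt_sq hn'.le, ← Real.sqrt_mul (by positivity), Real.sqrt_sq hn'.le]
    congr 1
    field_simp

lemma one_lt_log_natCast_add_three (k : ℕ) : 1 < Real.log (k + 3) := by
  rw [Real.lt_log_iff_exp_lt (by positivity)]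
  linarith [Real.exp_one_lt_three, (Nat.cast_nonneg k : (0 : ℝ) ≤ k)]

lemma log_natCast_add_three_pos (k : ℕ) : 0 < Real.log (k + 3) :=
  one_pos.trans (one_lt_log_natCast_add_three k)

lemma truncLevel_pos (k : ℕ) : 0 < truncLevel k :=
  Real.sqrt_pos.mpr (div_pos (by positivity) (log_natCast_add_three_pos k))

lemma dyadicRate_pos (k : ℕ) : 0 < dyadicRate k :=
  Real.sqrt_pos.mpr (mul_pos (by positivity) (log_natCast_add_three_pos k))

lemma dyadicRate_eq_truncLevel_mul (k : ℕ) : dyadicRate k = truncLevel k * Real.log (k + 3) := by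
  rw [dyadicRate, truncLevel, Real.sqrt_div (by positivity), Real.sqrt_mul (by positivity),
    div_mul_eq_mul_div, mul_div_assoc, Real.div_sqrt]

lemma truncLevel_mul_dyadicRate (k : ℕ) : truncLevel k * dyadicRate k = 2 ^ k := by
  have hlog := log_natCast_add_three_pos k
  rw [dyadicRate_eq_truncLevel_mul, truncLevel, ← mul_assoc, Real.mul_self_sqrt (by positivity),
    div_mul_cancel₀ _ hlog.ne']

lemma truncLevel_le_mul_succ (k : ℕ) : truncLevel k ≤ 7 / 8 * truncLevel (k + 1) := by
  have hlog := log_natCast_add_three_pos k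
  have hlog_succ := log_natCast_add_three_pos (k + 1)
  have hlog_le : 2 * Real.log ((k + 1 : ℕ) + 3) ≤ 3 * Real.log (k + 3) := by
    have hk : (0 : ℝ) ≤ k := k.cast_nonneg
    have hpow : ((k + 1 : ℕ) + 3 : ℝ) ^ 2 ≤ (k + 3) ^ 3 := by
      push_cast
      nlinarith [mul_nonneg hk hk, mul_nonneg hk (mul_nonneg hk hk)]
    simpa only [Real.log_pow, Nat.cast_ofNat] using Real.log_le_log (by positivity) hpow
  rw [truncLevel, truncLevel, ← Real.sqrt_sq (by norm_num : (0 : ℝ) ≤ 7 / 8),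
    ← Real.sqrt_mul (by positivity)]
  refine Real.sqrt_le_sqrt ?_
  rw [← mul_div_assoc, div_le_div_iff₀ hlog hlog_succ, pow_succ (2 : ℝ) k]
  nlinarith [pow_pos (two_pos : (0 : ℝ) < 2) k]

lemma sum_range_succ_truncLevel_le (K : ℕ) :
    ∑ k ∈ Finset.range (K + 1), truncLevel k ≤ 8 * truncLevel K := by
  induction K with
  | zero =>
    rw [zero_add, Finset.sum_range_one]
    linarith [truncLevel_pos 0]
  | succ K ih =>
    rw [Finset.sum_range_succ]
    linarith [truncLevel_le_mul_succ K]

lemma sum_truncLevel_le_of_le {y : ℝ} (hy : 0 ≤ y) (K : ℕ) :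
    ∑ k ∈ Finset.range K with truncLevel k ≤ y, truncLevel k ≤ 8 * y := by
  induction K with
  | zero => simpa using hy
  | succ K ih =>
    by_cases h : truncLevel K ≤ y
    · calc ∑ k ∈ Finset.range (K + 1) with truncLevel k ≤ y, truncLevel k
          ≤ ∑ k ∈ Finset.range (K + 1), truncLevel k :=
            Finset.sum_le_sum_of_subset_of_nonneg (Finset.filter_subset _ _)
              fun k _ _ => (truncLevel_pos k).le
        _ ≤ 8 * truncLevel K := sum_range_succ_truncLevel_le K
        _ ≤ 8 * y := by gcongr
    · rwa [Finset.range_add_one, Finset.filter_insert, if_neg h]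

lemma two_pow_log_add_one_le {n : ℕ} (hn : n ≠ 0) : (2 : ℝ) ^ (Nat.log 2 n + 1) ≤ 2 * n := by
  rw [pow_succ, mul_comm]
  gcongr
  exact_mod_cast Nat.pow_log_le_self 2 hn

lemma isBigO_dyadicRate_log :
    (fun n => dyadicRate (Nat.log 2 n + 1)) =O[atTop] fun n : ℕ => n * lilRate n := by
  refine IsBigO.of_bound (√4) ?_
  filter_upwards [tendsto_log_natCast.eventually_ge_atTop 4, eventually_ne_atTop 0] with n hlog hn
  have hlog_two_mul : (Nat.log 2 n : ℝ) * Real.log 2 ≤ Real.log n := by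
    rw [← Real.log_pow]
    exact Real.log_le_log (by positivity) (mod_cast Nat.pow_log_le_self 2 hn)
  have hloglog : Real.log ((Nat.log 2 n + 1 : ℕ) + 3) ≤ 2 * Real.log (Real.log n) := by
    have hsq : ((Nat.log 2 n + 1 : ℕ) + 3 : ℝ) ≤ Real.log n ^ 2 := by
      push_cast
      nlinarith [Real.log_two_gt_d9, (Nat.cast_nonneg _ : (0 : ℝ) ≤ Nat.log 2 n)]
    simpa only [Real.log_pow, Nat.cast_ofNat] using Real.log_le_log (by positivity) hsq
  rw [natCast_mul_lilRate, Real.norm_of_nonneg (dyadicRate_pos _).le,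
    Real.norm_of_nonneg (Real.sqrt_nonneg _), ← Real.sqrt_mul (by norm_num), dyadicRate]
  refine Real.sqrt_le_sqrt ?_
  calc (2 : ℝ) ^ (Nat.log 2 n + 1) * Real.log ((Nat.log 2 n + 1 : ℕ) + 3)
      ≤ (2 * n) * (2 * Real.log (Real.log n)) :=
        mul_le_mul (two_pow_log_add_one_le hn) hloglog (log_natCast_add_three_pos _).le
          (by positivity)
    _ = 4 * (n * Real.log (Real.log n)) := by ring

lemma isBigO_comp_log_of_dyadic {S R : ℕ → ℝ}
    (h : ∀ᶠ k in atTop, ∀ n ≤ 2 ^ k, |S n| ≤ R k) :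
    S =O[atTop] fun n => R (Nat.log 2 n + 1) := by
  obtain ⟨K, hK⟩ := eventually_atTop.mp h
  refine IsBigO.of_bound' ?_
  filter_upwards [eventually_ge_atTop (2 ^ K)] with n hn
  refine (hK _ ?_ n (Nat.lt_pow_succ_log_self one_lt_two n).le).trans (le_abs_self _)
  exact (Nat.le_log_of_pow_le one_lt_two hn).trans (Nat.le_succ _)

lemma isBigO_div_natCast {S r : ℕ → ℝ} (h : S =O[atTop] fun n => n * r n) :
    (fun n => S n / n) =O[atTop] r := by
  refine (h.mul (isBigO_refl (fun n : ℕ => (n : ℝ)⁻¹) atTop)).congr'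
    (Eventually.of_forall fun n => (div_eq_mul_inv _ _).symm) ?_
  filter_upwards [eventually_ne_atTop 0] with n hn
  have : (n : ℝ) ≠ 0 := Nat.cast_ne_zero.mpr hn
  field_simp

end Rates

section IID

variable {Ω 𝓧 : Type*} [MeasurableSpace Ω] [MeasurableSpace 𝓧] {P : Measure Ω} {μ : Measure 𝓧}
  {X : ℕ → Ω → 𝓧}

/-- Under `P`, the sequence `X` is independent and every term has law `μ`. -/
structure IsIID (X : ℕ → Ω → 𝓧) (μ : Measure 𝓧) (P : Measure Ω) : Prop where
  iIndepFun : iIndepFun X P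
  measurePreserving (i : ℕ) : MeasurePreserving (X i) P μ

namespace IsIID

lemma isProbabilityMeasure (hX : IsIID X μ P) : IsProbabilityMeasure P :=
  hX.iIndepFun.isProbabilityMeasure

lemma isProbabilityMeasure_law (hX : IsIID X μ P) : IsProbabilityMeasure μ := by
  have := hX.isProbabilityMeasure
  rw [← (hX.measurePreserving 0).map_eq]
  exact Measure.isProbabilityMeasure_map (hX.measurePreserving 0).aemeasurable

lemma integral_comp (hX : IsIID X μ P) {f : 𝓧 → ℝ} (hf : AEStronglyMeasurable f μ) (i : ℕ) :
    ∫ ω, f (X i ω) ∂P = ∫ x, f x ∂μ := by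
  rw [← (hX.measurePreserving i).map_eq] at hf ⊢
  exact (integral_map (hX.measurePreserving i).aemeasurable hf).symm

lemma measurePreserving_prodMk (hX : IsIID X μ P) {i j : ℕ} (hij : i ≠ j) :
    MeasurePreserving (fun ω => (X i ω, X j ω)) P (μ.prod μ) := by
  have := hX.isProbabilityMeasure
  have hi := hX.measurePreserving i
  have hj := hX.measurePreserving j
  refine ⟨hi.measurable.prodMk hj.measurable, ?_⟩
  rw [(indepFun_iff_map_prod_eq_prod_map_map hi.aemeasurable hj.aemeasurable).mp
    (hX.iIndepFun.indepFun hij), hi.map_eq, hj.map_eq]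

end IsIID

end IID

section LawOfIteratedLogarithm

variable {Ω 𝓧 : Type*} [MeasurableSpace Ω] [MeasurableSpace 𝓧] {P : Measure Ω} {μ : Measure 𝓧}
  {X : ℕ → Ω → 𝓧} {f : 𝓧 → ℝ}

lemma ae_eventually_le_of_summable_integral_div {B : ℕ → Ω → ℝ} {R : ℕ → ℝ}
    (hint : ∀ k, Integrable (B k) P) (hB : ∀ k, 0 ≤ B k) (hR : ∀ k, 0 < R k)
    (hsum : Summable fun k => (∫ ω, B k ω ∂P) / R k) :
    ∀ᵐ ω ∂P, ∀ᶠ k in atTop, B k ω ≤ R k := by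
  have heLpNorm : ∀ k, eLpNorm (fun ω => B k ω / R k) 1 P =
      ENNReal.ofReal ((∫ ω, B k ω ∂P) / R k) := fun k => by
    rw [eLpNorm_one_eq_lintegral_enorm, ← ofReal_integral_norm_eq_lintegral_enorm
      ((hint k).div_const _), ← integral_div]
    congr 1
    exact integral_congr_ae (ae_of_all _ fun ω =>
      Real.norm_of_nonneg (div_nonneg (hB k ω) (hR k).le))
  filter_upwards [summable_norm_of_tsum_eLpNorm_ne_top le_rfl
    (fun k => ((hint k).div_const (R k)).aestronglyMeasurable)
    (by simpa only [heLpNorm] using hsum.tsum_ofReal_ne_top)] with ω hω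
  filter_upwards [hω.tendsto_atTop_zero.eventually_le_const one_pos] with k hk
  exact (div_le_one (hR k)).mp ((le_abs_self _).trans hk)

lemma abs_sub_truncation_le {α : Type*} (f : α → ℝ) (A : ℝ) (x : α) :
    |f x - truncation f A x| ≤ |f x| := by
  simp only [truncation, Set.indicator, id, Function.comp_apply]
  split_ifs <;> simp

lemma integrable_abs_sub_truncation [IsFiniteMeasure μ] (hf : Integrable f μ) (A : ℝ) :
    Integrable (fun x => |f x - truncation f A x|) μ :=
  (hf.sub hf.1.integrable_truncation).abs

lemma sum_truncLevel_mul_abs_sub_truncation_le {α : Type*} (f : α → ℝ) (x : α) (K : ℕ) :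
    ∑ k ∈ Finset.range K, truncLevel k * |f x - truncation f (truncLevel k) x| ≤ 8 * f x ^ 2 :=
  calc ∑ k ∈ Finset.range K, truncLevel k * |f x - truncation f (truncLevel k) x|
      ≤ ∑ k ∈ Finset.range K with truncLevel k ≤ |f x|, truncLevel k * |f x| := by
        rw [Finset.sum_filter]
        refine Finset.sum_le_sum fun k _ => ?_
        split_ifs with h
        · exact mul_le_mul_of_nonneg_left (abs_sub_truncation_le f _ x) (truncLevel_pos k).le
        · rw [truncation_eq_self (not_le.mp h), sub_self, abs_zero, mul_zero]
    _ ≤ 8 * |f x| * |f x| := by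
        rw [← Finset.sum_mul]
        exact mul_le_mul_of_nonneg_right (sum_truncLevel_le_of_le (abs_nonneg _) K) (abs_nonneg _)
    _ = 8 * f x ^ 2 := by rw [mul_assoc, abs_mul_abs_self, sq]

lemma summable_truncLevel_mul_integral [IsFiniteMeasure μ] (hf : MemLp f 2 μ) :
    Summable fun k => truncLevel k * ∫ x, |f x - truncation f (truncLevel k) x| ∂μ := by
  have hint : ∀ k, Integrable
      (fun x => truncLevel k * |f x - truncation f (truncLevel k) x|) μ := fun k =>
    (integrable_abs_sub_truncation (hf.integrable one_le_two) _).const_mul _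
  refine summable_of_sum_range_le (c := 8 * ∫ x, f x ^ 2 ∂μ) (fun k =>
    mul_nonneg (truncLevel_pos k).le (integral_nonneg fun x => abs_nonneg _)) fun K => ?_
  simp_rw [← integral_const_mul]
  rw [← integral_finsetSum _ fun k _ => hint k]
  exact integral_mono (integrable_finsetSum _ fun k _ => hint k) (hf.integrable_sq.const_mul 8)
    fun x => sum_truncLevel_mul_abs_sub_truncation_le f x K

lemma abs_truncation_sub_integral_le [IsProbabilityMeasure μ] (f : 𝓧 → ℝ) {A : ℝ} (hA : 0 ≤ A)
    (x : 𝓧) : |truncation f A x - ∫ y, truncation f A y ∂μ| ≤ 2 * A := by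
  have htrunc : ∀ y, |truncation f A y| ≤ A := fun y =>
    (abs_truncation_le_bound f A y).trans_eq (abs_of_nonneg hA)
  have hmean : |∫ y, truncation f A y ∂μ| ≤ A := by
    simpa using norm_integral_le_of_norm_le_const (f := truncation f A) (ae_of_all μ htrunc)
  rw [two_mul]
  exact (abs_sub _ _).trans (add_le_add (htrunc x) hmean)

lemma integral_truncation_sub_integral [IsProbabilityMeasure μ] (hf : AEStronglyMeasurable f μ)
    (A : ℝ) : ∫ x, (truncation f A x - ∫ y, truncation f A y ∂μ) ∂μ = 0 := by
  rw [integral_sub hf.integrable_truncation (integrable_const _), integral_const, probReal_univ,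
    one_smul, sub_self]

lemma integral_sq_truncation_sub_integral_le [IsProbabilityMeasure μ] (hf : MemLp f 2 μ) (A : ℝ) :
    ∫ x, (truncation f A x - ∫ y, truncation f A y ∂μ) ^ 2 ∂μ ≤ ∫ x, f x ^ 2 ∂μ := by
  rw [← variance_eq_integral hf.1.truncation.aemeasurable]
  refine (variance_le_expectation_sq hf.1.truncation).trans ?_
  exact integral_mono hf.1.memLp_truncation.integrable_sq hf.integrable_sq fun x =>
    sq_le_sq.mpr (abs_truncation_le_abs_self f A x)

lemma eventually_two_pow_mul_abs_integral_truncation_sub_le [IsFiniteMeasure μ]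
    (hf : MemLp f 2 μ) :
    ∀ᶠ k in atTop, 2 ^ k * |∫ x, truncation f (truncLevel k) x ∂μ - ∫ x, f x ∂μ| ≤
      dyadicRate k := by
  filter_upwards [(summable_truncLevel_mul_integral hf).tendsto_atTop_zero.eventually_le_const
    one_pos] with k hk
  rw [abs_sub_comm, ← integral_sub (hf.integrable one_le_two) hf.1.integrable_truncation,
    ← truncLevel_mul_dyadicRate, mul_right_comm]
  refine mul_le_of_le_one_left (dyadicRate_pos k).le (le_trans ?_ hk)
  exact mul_le_mul_of_nonneg_left abs_integral_le_integral_abs (truncLevel_pos k).le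

namespace IsIID

lemma ae_eventually_sum_abs_sub_truncation_le (hX : IsIID X μ P) (hf : MemLp f 2 μ) :
    ∀ᵐ ω ∂P, ∀ᶠ k in atTop, ∑ i ∈ Finset.range (2 ^ k),
      |f (X i ω) - truncation f (truncLevel k) (X i ω)| ≤ dyadicRate k := by
  have := hX.isProbabilityMeasure_law
  have hint : ∀ k, Integrable (fun x => |f x - truncation f (truncLevel k) x|) μ := fun k =>
    integrable_abs_sub_truncation (hf.integrable one_le_two) _
  have hint_comp : ∀ k i, Integrable
      (fun ω => |f (X i ω) - truncation f (truncLevel k) (X i ω)|) P := fun k i =>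
    (hX.measurePreserving i).integrable_comp_of_integrable (hint k)
  refine ae_eventually_le_of_summable_integral_div
    (fun k => integrable_finsetSum _ fun i _ => hint_comp k i)
    (fun k ω => Finset.sum_nonneg fun i _ => abs_nonneg _) dyadicRate_pos ?_
  refine (summable_truncLevel_mul_integral hf).congr fun k => ?_
  rw [integral_finsetSum _ fun i _ => hint_comp k i,
    Finset.sum_congr rfl fun i _ => hX.integral_comp (hint k).aestronglyMeasurable i,
    Finset.sum_const, Finset.card_range, nsmul_eq_mul, Nat.cast_pow, Nat.cast_ofNat,
    ← truncLevel_mul_dyadicRate, mul_right_comm, mul_div_cancel_right₀ _ (dyadicRate_pos k).ne']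

lemma measure_exists_le_abs_sum_truncation_sub_le (hX : IsIID X μ P) (hf : Measurable f)
    (hL2 : MemLp f 2 μ) (k : ℕ) :
    P {ω | ∃ n ≤ 2 ^ k, ((∫ x, f x ^ 2 ∂μ) / 2 + 4) * dyadicRate k ≤
      |∑ i ∈ Finset.range n, (truncation f (truncLevel k) (X i ω) -
        ∫ x, truncation f (truncLevel k) x ∂μ)|} ≤
      2 * ENNReal.ofReal ((k + 3 : ℝ) ^ 2)⁻¹ := by
  have := hX.isProbabilityMeasure_law
  have hlevel := truncLevel_pos k
  have hrate := dyadicRate_pos k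
  have : 0 ≤ ∫ x, f x ^ 2 ∂μ := integral_nonneg fun x => sq_nonneg _
  have hmeas : Measurable fun x => truncation f (truncLevel k) x -
      ∫ x, truncation f (truncLevel k) x ∂μ :=
    ((measurable_id.indicator measurableSet_Ioc).comp hf).sub_const _
  refine (measure_exists_le_abs_sum_range_le_exp (t := 1 / (2 * truncLevel k))
    (fun i => hmeas.comp (hX.measurePreserving i).measurable)
    (hX.iIndepFun.comp (fun _ => _) fun _ => hmeas) (by positivity)
    (fun i ω => abs_truncation_sub_integral_le f hlevel.le (X i ω))
    (one_div_mul_cancel (by positivity)).le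
    (fun i => (hX.integral_comp hmeas.aestronglyMeasurable i).trans
      (integral_truncation_sub_integral hL2.1 _))
    (fun i => (hX.integral_comp (hmeas.pow_const 2).aestronglyMeasurable i).trans_le
      (integral_sq_truncation_sub_integral_le hL2 _)) (by positivity) (2 ^ k)).trans_eq ?_
  have hexponent : (2 ^ k : ℕ) * ((1 / (2 * truncLevel k)) ^ 2 * ∫ x, f x ^ 2 ∂μ) -
      1 / (2 * truncLevel k) * (((∫ x, f x ^ 2 ∂μ) / 2 + 4) * dyadicRate k) =
        -((2 : ℕ) * Real.log (k + 3)) := by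
    rw [Nat.cast_pow, Nat.cast_ofNat, ← truncLevel_mul_dyadicRate, dyadicRate_eq_truncLevel_mul]
    field_simp
    ring
  rw [hexponent, Real.exp_neg, Real.exp_nat_mul, Real.exp_log (by positivity)]

lemma ae_eventually_abs_sum_truncation_sub_lt (hX : IsIID X μ P) (hf : Measurable f)
    (hL2 : MemLp f 2 μ) :
    ∀ᵐ ω ∂P, ∀ᶠ k in atTop, ∀ n ≤ 2 ^ k,
      |∑ i ∈ Finset.range n, (truncation f (truncLevel k) (X i ω) -
        ∫ x, truncation f (truncLevel k) x ∂μ)| <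
          ((∫ x, f x ^ 2 ∂μ) / 2 + 4) * dyadicRate k := by
  have hsummable : Summable fun k : ℕ => ((k + 3 : ℝ) ^ 2)⁻¹ := by
    simpa using (summable_nat_add_iff 3).mpr (Real.summable_nat_pow_inv.mpr one_lt_two)
  have hprob := ne_top_of_le_ne_top (by
      rw [ENNReal.tsum_mul_left]
      exact ENNReal.mul_ne_top ENNReal.ofNat_ne_top hsummable.tsum_ofReal_ne_top)
    (ENNReal.tsum_le_tsum (hX.measure_exists_le_abs_sum_truncation_sub_le hf hL2))
  filter_upwards [ae_eventually_notMem hprob] with ω hω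
  simpa only [Set.mem_ofPred_eq, not_exists, not_and, not_le] using hω

/-- The upper half of the Hartman–Wintner law of the iterated logarithm, up to a constant. -/
theorem ae_isBigO_sum_div_sub (hX : IsIID X μ P) (hf : Measurable f) (hL2 : MemLp f 2 μ) :
    ∀ᵐ ω ∂P, (fun n : ℕ => (∑ i ∈ Finset.range n, f (X i ω)) / n - ∫ x, f x ∂μ) =O[atTop]
      lilRate := by
  have := hX.isProbabilityMeasure_law
  filter_upwards [hX.ae_eventually_sum_abs_sub_truncation_le hL2,
    hX.ae_eventually_abs_sum_truncation_sub_lt hf hL2] with ω htail hcentred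
  set m := ∫ x, f x ∂μ
  set A := (∫ x, f x ^ 2 ∂μ) / 2 + 4
  have hdyadic : ∀ᶠ k in atTop, ∀ n ≤ 2 ^ k,
      |∑ i ∈ Finset.range n, (f (X i ω) - m)| ≤ (A + 2) * dyadicRate k := by
    filter_upwards [htail, hcentred, eventually_two_pow_mul_abs_integral_truncation_sub_le hL2]
      with k htail hcentred hbias n hn
    set T := truncation f (truncLevel k)
    have hsplit : ∑ i ∈ Finset.range n, (f (X i ω) - m) =
        ∑ i ∈ Finset.range n, (f (X i ω) - T (X i ω)) +
          ∑ i ∈ Finset.range n, (T (X i ω) - ∫ x, T x ∂μ) + n * (∫ x, T x ∂μ - m) := by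
      simp only [Finset.sum_sub_distrib, Finset.sum_const, Finset.card_range, nsmul_eq_mul]
      ring
    have htail_n : |∑ i ∈ Finset.range n, (f (X i ω) - T (X i ω))| ≤ dyadicRate k :=
      (Finset.abs_sum_le_sum_abs _ _).trans ((Finset.sum_le_sum_of_subset_of_nonneg
        (Finset.range_mono hn) fun i _ _ => abs_nonneg _).trans htail)
    have hbias_n : |n * (∫ x, T x ∂μ - m)| ≤ dyadicRate k := by
      rw [abs_mul, Nat.abs_cast]
      exact (mul_le_mul_of_nonneg_right (mod_cast hn) (abs_nonneg _)).trans hbias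
    rw [hsplit]
    linarith [abs_add_three (∑ i ∈ Finset.range n, (f (X i ω) - T (X i ω)))
      (∑ i ∈ Finset.range n, (T (X i ω) - ∫ x, T x ∂μ)) (n * (∫ x, T x ∂μ - m)), hcentred n hn]
  have hsum : (fun n => ∑ i ∈ Finset.range n, (f (X i ω) - m)) =O[atTop]
      fun n => n * lilRate n :=
    (isBigO_comp_log_of_dyadic hdyadic).trans (isBigO_dyadicRate_log.const_mul_left _)
  refine (isBigO_div_natCast hsum).congr' ?_ EventuallyEq.rfl
  filter_upwards [eventually_ne_atTop 0] with n hn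
  rw [Finset.sum_sub_distrib, Finset.sum_const, Finset.card_range, nsmul_eq_mul, sub_div,
    mul_div_cancel_left₀ _ (Nat.cast_ne_zero.mpr hn)]

end IsIID

end LawOfIteratedLogarithm

section RademacherMenshov

variable {Ω : Type*} [MeasurableSpace Ω] {P : Measure Ω}

/-- The sum of the squares of the left half blocks in all dyadic subdivisions of
`d 0, …, d (2 ^ k - 1)`, together with the squares of the terms themselves. Up to a factor `k + 1`
it dominates the squares of all partial sums. -/
def dyadicEnergy : ℕ → (ℕ → ℝ) → ℝ
  | 0, d => d 0 ^ 2
  | k + 1, d => dyadicEnergy k d + dyadicEnergy k (fun j => d (2 ^ k + j)) +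
      (∑ j ∈ Finset.range (2 ^ k), d j) ^ 2

lemma dyadicEnergy_nonneg (k : ℕ) (d : ℕ → ℝ) : 0 ≤ dyadicEnergy k d := by
  induction k generalizing d with
  | zero => exact sq_nonneg _
  | succ k ih => exact add_nonneg (add_nonneg (ih _) (ih _)) (sq_nonneg _)

lemma sq_sum_range_le_dyadicEnergy (d : ℕ → ℝ) {k n : ℕ} (hn : n ≤ 2 ^ k) :
    (∑ j ∈ Finset.range n, d j) ^ 2 ≤ (k + 1) * dyadicEnergy k d := by
  induction k generalizing d n with
  | zero =>
    rw [pow_zero] at hn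
    interval_cases n
    · simpa [dyadicEnergy] using sq_nonneg (d 0)
    · simp [dyadicEnergy]
  | succ k ih =>
    set x := ∑ j ∈ Finset.range (2 ^ k), d j
    set E₁ := dyadicEnergy k d
    set E₂ := dyadicEnergy k (fun j => d (2 ^ k + j))
    have hE₁ : 0 ≤ E₁ := dyadicEnergy_nonneg k _
    have hE₂ : 0 ≤ E₂ := dyadicEnergy_nonneg k _
    suffices h : (∑ j ∈ Finset.range n, d j) ^ 2 ≤ (k + 2) * (E₁ + E₂ + x ^ 2) by
      rw [dyadicEnergy]
      push_cast
      linarith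
    rcases le_total n (2 ^ k) with hn_le | hn_ge
    · refine (ih d hn_le).trans ?_
      gcongr
      · norm_num
      · linarith [sq_nonneg x]
    · obtain ⟨m, rfl⟩ := Nat.exists_eq_add_of_le hn_ge
      rw [Finset.sum_range_add]
      set y := ∑ j ∈ Finset.range m, d (2 ^ k + j)
      have hy : y ^ 2 ≤ (k + 1) * E₂ := ih _ (by rw [pow_succ] at hn; omega)
      -- Cauchy–Schwarz with weights `1` and `k + 1`
      have hxy : (k + 1) * (x + y) ^ 2 ≤ (k + 1) * ((k + 2) * (x ^ 2 + E₂)) := by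
        nlinarith [sq_nonneg ((k + 1) * x - y)]
      calc (x + y) ^ 2 ≤ (k + 2) * (x ^ 2 + E₂) := le_of_mul_le_mul_left hxy (by positivity)
        _ ≤ (k + 2) * (E₁ + E₂ + x ^ 2) := by gcongr ?_ * ?_; linarith

lemma integrable_dyadicEnergy {d : ℕ → Ω → ℝ} (hd : ∀ j, MemLp (d j) 2 P) (k : ℕ) :
    Integrable (fun ω => dyadicEnergy k fun j => d j ω) P := by
  induction k generalizing d with
  | zero => exact (hd 0).integrable_sq
  | succ k ih =>
    exact ((ih hd).add (ih fun j => hd (2 ^ k + j))).add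
      (memLp_finsetSum _ fun j _ => hd j).integrable_sq

lemma integral_sq_sum_of_orthogonal {ι : Type*} {d : ι → Ω → ℝ} (hd : ∀ j, MemLp (d j) 2 P)
    (horth : Pairwise fun i j => ∫ ω, d i ω * d j ω ∂P = 0) (s : Finset ι) :
    ∫ ω, (∑ j ∈ s, d j ω) ^ 2 ∂P = ∑ j ∈ s, ∫ ω, d j ω ^ 2 ∂P := by
  have hint : ∀ i j, Integrable (fun ω => d i ω * d j ω) P := fun i j =>
    (hd i).integrable_mul (hd j)
  simp_rw [sq, Finset.sum_mul_sum]
  rw [integral_finsetSum _ fun i _ => integrable_finsetSum _ fun j _ => hint i j]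
  refine Finset.sum_congr rfl fun i hi => ?_
  rw [integral_finsetSum _ fun j _ => hint i j,
    Finset.sum_eq_single_of_mem i hi fun j _ hji => horth hji.symm]

lemma integral_dyadicEnergy_le {d : ℕ → Ω → ℝ} (hd : ∀ j, MemLp (d j) 2 P)
    (horth : Pairwise fun i j => ∫ ω, d i ω * d j ω ∂P = 0) (k : ℕ) :
    ∫ ω, dyadicEnergy k (fun j => d j ω) ∂P ≤
      (k + 1) * ∑ j ∈ Finset.range (2 ^ k), ∫ ω, d j ω ^ 2 ∂P := by
  induction k generalizing d with
  | zero => simp [dyadicEnergy]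
  | succ k ih =>
    have hd_shift : ∀ j, MemLp (d (2 ^ k + j)) 2 P := fun j => hd _
    have hint := integrable_dyadicEnergy hd k
    have hint_shift := integrable_dyadicEnergy hd_shift k
    have hleft := ih hd horth
    have hright := ih hd_shift (horth.comp_of_injective (add_right_injective (2 ^ k)))
    have hshift_nonneg : 0 ≤ ∑ j ∈ Finset.range (2 ^ k), ∫ ω, d (2 ^ k + j) ω ^ 2 ∂P :=
      Finset.sum_nonneg fun j _ => integral_nonneg fun ω => sq_nonneg _
    simp only [dyadicEnergy]
    rw [integral_add (by exact hint.add hint_shift)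
      (memLp_finsetSum _ fun j _ => hd j).integrable_sq, integral_add hint hint_shift,
      integral_sq_sum_of_orthogonal hd horth, pow_succ, mul_two, Finset.sum_range_add]
    push_cast
    linarith

lemma summable_add_one_sq_mul_geometric {r : ℝ} (h0 : 0 < r) (h1 : r < 1) :
    Summable fun k : ℕ => ((k : ℝ) + 1) ^ 2 * r ^ k := by
  refine (((summable_nat_add_iff 1).mpr (summable_pow_mul_geometric_of_norm_lt_one 2
    (r := r) (by rwa [Real.norm_of_nonneg h0.le]))).mul_right r⁻¹).congr fun k => ?_
  rw [pow_succ r k, ← mul_assoc, mul_inv_cancel_right₀ h0.ne', Nat.cast_add_one]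

lemma ae_isBigO_sq_mul_sqrt_of_integral_le {T B : ℕ → Ω → ℝ} {c : ℝ}
    (hB : ∀ k, Integrable (B k) P) (hTB : ∀ k, ∀ n ≤ 2 ^ k, ∀ ω, |T n ω| ≤ B k ω)
    (hc : ∀ k : ℕ, ∫ ω, B k ω ∂P ≤ (k + 1) ^ 2 * (2 ^ k) ^ 2 * c) :
    ∀ᵐ ω ∂P, (fun n => T n ω) =O[atTop] fun n : ℕ => (n : ℝ) ^ 2 * √n := by
  have hB0 : ∀ k, 0 ≤ B k := fun k ω => (abs_nonneg _).trans (hTB k 0 (Nat.zero_le _) ω)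
  have hsqrt : ∀ k, √(2 ^ k) = √2 ^ k := fun k => by
    rw [Real.sqrt_eq_iff_mul_self_eq (by positivity) (by positivity), ← mul_pow,
      Real.mul_self_sqrt two_pos.le]
  have hsum : Summable fun k => (∫ ω, B k ω ∂P) / ((2 ^ k) ^ 2 * √(2 ^ k)) := by
    refine Summable.of_nonneg_of_le
      (fun k => div_nonneg (integral_nonneg (hB0 k)) (by positivity)) (fun k => ?_)
      ((summable_add_one_sq_mul_geometric (r := (√2)⁻¹) (by positivity)
        (inv_lt_one_of_one_lt₀ (Real.lt_sqrt_of_sq_lt (by norm_num)))).mul_right c)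
    rw [div_le_iff₀ (by positivity)]
    refine (hc k).trans_eq ?_
    rw [hsqrt, inv_pow]
    field_simp
  filter_upwards [ae_eventually_le_of_summable_integral_div hB hB0 (fun k => by positivity) hsum]
    with ω hω
  refine (isBigO_comp_log_of_dyadic (hω.mono fun k hk n hn => (hTB k n hn ω).trans hk)).trans ?_
  refine IsBigO.of_bound (4 * √2) ?_
  filter_upwards [eventually_ne_atTop 0] with n hn
  rw [Real.norm_of_nonneg (by positivity), Real.norm_of_nonneg (by positivity)]
  have hpow := two_pow_log_add_one_le hn
  calc ((2 : ℝ) ^ (Nat.log 2 n + 1)) ^ 2 * √(2 ^ (Nat.log 2 n + 1))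
      ≤ (2 * n) ^ 2 * √(2 * n) := by gcongr
    _ = 4 * √2 * (n ^ 2 * √n) := by rw [Real.sqrt_mul two_pos.le]; ring

end RademacherMenshov

section Kernels

variable {𝓧 : Type*} [MeasurableSpace 𝓧] {μ : Measure 𝓧} {φ : 𝓧 → 𝓧 → ℝ}

/-- A square-integrable kernel whose conditional mean given its first argument vanishes. -/
structure IsRightDegenerate (μ : Measure 𝓧) (φ : 𝓧 → 𝓧 → ℝ) : Prop where
  measurable : Measurable (Function.uncurry φ)
  memLp : MemLp (Function.uncurry φ) 2 (μ.prod μ)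
  ae_integral_eq_zero : ∀ᵐ x ∂μ, ∫ y, φ x y ∂μ = 0

/-- The kernel `φ` recentred by its conditional mean given the first argument. -/
def centerRight (μ : Measure 𝓧) (φ : 𝓧 → 𝓧 → ℝ) (x y : 𝓧) : ℝ :=
  φ x y - ∫ z, φ x z ∂μ

lemma measurable_integral_right [SFinite μ] (hφ : Measurable (Function.uncurry φ)) :
    Measurable fun x => ∫ y, φ x y ∂μ :=
  hφ.stronglyMeasurable.integral_prod_right'.measurable

lemma memLp_integral_right [IsProbabilityMeasure μ] {p : ENNReal} (hp : 1 ≤ p) (hp_top : p ≠ ⊤)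
    (hφ : Measurable (Function.uncurry φ)) (hL : MemLp (Function.uncurry φ) p (μ.prod μ)) :
    MemLp (fun x => ∫ y, φ x y ∂μ) p μ := by
  have hp_zero : p ≠ 0 := (one_pos.trans_le hp).ne'
  have hp_toReal : 0 < p.toReal := ENNReal.toReal_pos hp_zero hp_top
  refine ⟨(measurable_integral_right hφ).aestronglyMeasurable, ?_⟩
  rw [eLpNorm_lt_top_iff_lintegral_rpow_enorm_lt_top hp_zero hp_top]
  refine lt_of_le_of_lt ?_
    ((eLpNorm_lt_top_iff_lintegral_rpow_enorm_lt_top hp_zero hp_top).mp hL.2)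
  rw [lintegral_prod _ (hφ.enorm.pow_const _).aemeasurable]
  refine lintegral_mono fun x => ?_
  have hjensen : ‖∫ y, φ x y ∂μ‖ₑ ≤ eLpNorm (φ x) p μ := by
    refine (enorm_integral_le_lintegral_enorm _).trans ?_
    rw [← eLpNorm_one_eq_lintegral_enorm]
    exact eLpNorm_le_eLpNorm_of_exponent_le hp
      (hφ.comp measurable_prodMk_left).aestronglyMeasurable
  rw [eLpNorm_eq_lintegral_rpow_enorm_toReal hp_zero hp_top] at hjensen
  refine (ENNReal.rpow_le_rpow hjensen hp_toReal.le).trans_eq ?_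
  rw [← ENNReal.rpow_mul, one_div_mul_cancel hp_toReal.ne', ENNReal.rpow_one]
  rfl

lemma memLp_flip [SFinite μ] {p : ENNReal} (hL : MemLp (Function.uncurry φ) p (μ.prod μ)) :
    MemLp (Function.uncurry (flip φ)) p (μ.prod μ) :=
  hL.comp_measurePreserving Measure.measurePreserving_swap

variable [IsProbabilityMeasure μ]

lemma measurable_centerRight (hφ : Measurable (Function.uncurry φ)) :
    Measurable (Function.uncurry (centerRight μ φ)) :=
  hφ.sub ((measurable_integral_right hφ).comp measurable_fst)

lemma memLp_centerRight {p : ENNReal} (hp : 1 ≤ p) (hp_top : p ≠ ⊤)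
    (hφ : Measurable (Function.uncurry φ)) (hL : MemLp (Function.uncurry φ) p (μ.prod μ)) :
    MemLp (Function.uncurry (centerRight μ φ)) p (μ.prod μ) :=
  hL.sub ((memLp_integral_right hp hp_top hφ hL).comp_measurePreserving measurePreserving_fst)

lemma isRightDegenerate_centerRight (hφ : Measurable (Function.uncurry φ))
    (hL2 : MemLp (Function.uncurry φ) 2 (μ.prod μ)) : IsRightDegenerate μ (centerRight μ φ) where
  measurable := measurable_centerRight hφ
  memLp := memLp_centerRight one_le_two ENNReal.ofNat_ne_top hφ hL2
  ae_integral_eq_zero := by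
    filter_upwards [(hL2.integrable one_le_two).prod_right_ae] with x hx
    simp only [Function.uncurry_apply_pair] at hx
    simp only [centerRight]
    rw [integral_sub hx (integrable_const _), integral_const, probReal_univ, one_smul, sub_self]

namespace IsRightDegenerate

lemma integral_eq_zero (hφ : IsRightDegenerate μ φ) :
    ∫ p, Function.uncurry φ p ∂(μ.prod μ) = 0 := by
  rw [integral_prod _ (hφ.memLp.integrable one_le_two)]
  exact integral_eq_zero_of_ae hφ.ae_integral_eq_zero

lemma flip_centerRight_flip (hφ : IsRightDegenerate μ φ) :
    IsRightDegenerate μ (flip (centerRight μ (flip φ))) := by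
  have hflip : Measurable (Function.uncurry (flip φ)) := hφ.measurable.comp measurable_swap
  have hcenter := isRightDegenerate_centerRight hflip (memLp_flip hφ.memLp)
  have hint := hφ.memLp.integrable one_le_two
  have hint_left : Integrable (fun y => ∫ z, φ z y ∂μ) μ := hint.integral_prod_right
  refine ⟨hcenter.measurable.comp measurable_swap, memLp_flip hcenter.memLp, ?_⟩
  filter_upwards [hφ.ae_integral_eq_zero, hint.prod_right_ae] with x hx hx_int
  simp only [Function.uncurry_apply_pair] at hx_int
  simp only [flip, centerRight]
  rw [integral_sub hx_int hint_left, hx, zero_sub, neg_eq_zero]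
  exact (integral_prod_symm _ hint).symm.trans hφ.integral_eq_zero

/-- Conditionally on `(Y, Z)` the mean of `φ (Y, Y')` is `∫ y, φ Y y = 0`. -/
lemma integral_mul_eq_zero {Ω : Type*} [MeasurableSpace Ω] {P : Measure Ω}
    [IsProbabilityMeasure P] (hφ : IsRightDegenerate μ φ) {Y Y' : Ω → 𝓧} {Z : Ω → ℝ}
    (hY : MeasurePreserving Y P μ) (hY' : MeasurePreserving Y' P μ) (hZ : Measurable Z)
    (hindep : IndepFun (fun ω => (Y ω, Z ω)) Y' P)
    (hint : Integrable (fun ω => φ (Y ω) (Y' ω) * Z ω) P) :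
    ∫ ω, φ (Y ω) (Y' ω) * Z ω ∂P = 0 := by
  have hV := hY.measurable.prodMk hZ
  have hVY := hV.prodMk hY'.measurable
  have hmap : P.map (fun ω => ((Y ω, Z ω), Y' ω)) = (P.map fun ω => (Y ω, Z ω)).prod μ := by
    rw [(indepFun_iff_map_prod_eq_prod_map_map hV.aemeasurable hY'.aemeasurable).mp hindep,
      hY'.map_eq]
  set F : (𝓧 × ℝ) × 𝓧 → ℝ := fun p => φ p.1.1 p.2 * p.1.2
  have hF : Measurable F :=
    (hφ.measurable.comp (measurable_fst.fst.prodMk measurable_snd)).mul measurable_fst.snd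
  have hF_int : Integrable F ((P.map fun ω => (Y ω, Z ω)).prod μ) := by
    rwa [← hmap, integrable_map_measure hF.aestronglyMeasurable hVY.aemeasurable]
  have : IsProbabilityMeasure (P.map fun ω => (Y ω, Z ω)) :=
    Measure.isProbabilityMeasure_map hV.aemeasurable
  calc ∫ ω, φ (Y ω) (Y' ω) * Z ω ∂P = ∫ p, F p ∂(P.map fun ω => (Y ω, Z ω)).prod μ := by
        rw [← hmap, integral_map hVY.aemeasurable hF.aestronglyMeasurable]
    _ = ∫ v, ∫ y, F (v, y) ∂μ ∂(P.map fun ω => (Y ω, Z ω)) := integral_prod _ hF_int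
    _ = ∫ ω, ∫ y, F ((Y ω, Z ω), y) ∂μ ∂P :=
        integral_map hV.aemeasurable
          hF.stronglyMeasurable.integral_prod_right'.aestronglyMeasurable
    _ = 0 := by
        refine integral_eq_zero_of_ae ?_
        filter_upwards [hY.quasiMeasurePreserving.ae hφ.ae_integral_eq_zero] with ω hω
        simp only [F, integral_mul_const, hω, zero_mul, Pi.zero_apply]

end IsRightDegenerate

end Kernels

section OffDiagonal

variable {𝓧 : Type*}

/-- The values `φ (x i) (x j)` of a kernel off the diagonal, extended by `0` to the diagonal. -/
def offDiag (φ : 𝓧 → 𝓧 → ℝ) (x : ℕ → 𝓧) (i j : ℕ) : ℝ :=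
  if i = j then 0 else φ (x i) (x j)

/-- The mean of `φ (x i) (x j)` over the `n - 1` indices `j < n` with `j ≠ i`. -/
def rowMean (φ : 𝓧 → 𝓧 → ℝ) (x : ℕ → 𝓧) (n i : ℕ) : ℝ :=
  (∑ j ∈ Finset.range n, offDiag φ x i j) / (n - 1)

/-- The mean of `φ (x i) (x j)` over all ordered pairs of distinct indices below `n`. -/
def offDiagMean (φ : 𝓧 → 𝓧 → ℝ) (x : ℕ → 𝓧) (n : ℕ) : ℝ :=
  (∑ i ∈ Finset.range n, rowMean φ x n i) / n

lemma offDiag_flip (φ : 𝓧 → 𝓧 → ℝ) (x : ℕ → 𝓧) (i j : ℕ) :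
    offDiag (flip φ) x i j = offDiag φ x j i := by
  simp only [offDiag, flip, eq_comm]

lemma sum_range_offDiag (φ : 𝓧 → 𝓧 → ℝ) (x : ℕ → 𝓧) (n i : ℕ) :
    ∑ j ∈ Finset.range n, offDiag φ x i j = ∑ j ∈ (Finset.range n).erase i, φ (x i) (x j) := by
  rw [← Finset.filter_ne, Finset.sum_filter]
  simp only [offDiag, ite_not]

lemma sum_sum_offDiag (φ : 𝓧 → 𝓧 → ℝ) (x : ℕ → 𝓧) (n : ℕ) :
    ∑ i ∈ Finset.range n, ∑ j ∈ Finset.range n, offDiag φ x i j =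
      ∑ j ∈ Finset.range n, ∑ i ∈ Finset.range j, offDiag φ x i j +
        ∑ j ∈ Finset.range n, ∑ i ∈ Finset.range j, offDiag (flip φ) x i j := by
  simp only [offDiag_flip]
  induction n with
  | zero => simp
  | succ n ih =>
    have hdiag : offDiag φ x n n = 0 := if_pos rfl
    simp only [Finset.sum_range_succ, Finset.sum_add_distrib, ih, hdiag]
    ring

lemma offDiagMean_eq_sum_div (φ : 𝓧 → 𝓧 → ℝ) (x : ℕ → 𝓧) (n : ℕ) :
    offDiagMean φ x n =
      (∑ i ∈ Finset.range n, ∑ j ∈ Finset.range n, offDiag φ x i j) / (n - 1) / n := by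
  simp only [offDiagMean, rowMean, Finset.sum_div]

lemma offDiagMean_flip (φ : 𝓧 → 𝓧 → ℝ) (x : ℕ → 𝓧) (n : ℕ) :
    offDiagMean (flip φ) x n = offDiagMean φ x n := by
  simp only [offDiagMean_eq_sum_div, offDiag_flip]
  rw [Finset.sum_comm]

lemma rowMean_mul_left (a : 𝓧 → ℝ) (φ : 𝓧 → 𝓧 → ℝ) (x : ℕ → 𝓧) (n i : ℕ) :
    rowMean (fun y z => a y * φ y z) x n i = a (x i) * rowMean φ x n i := by
  simp only [rowMean, offDiag, ← mul_div_assoc, Finset.mul_sum, mul_ite, mul_zero]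

lemma natCast_sub_one_ne_zero {n : ℕ} (hn : 2 ≤ n) : (n : ℝ) - 1 ≠ 0 :=
  sub_ne_zero.mpr (Nat.cast_ne_one.mpr (by omega))

variable [MeasurableSpace 𝓧]

lemma rowMean_eq_add_centerRight (μ : Measure 𝓧) (φ : 𝓧 → 𝓧 → ℝ) (x : ℕ → 𝓧) {n i : ℕ}
    (hn : 2 ≤ n) (hi : i < n) :
    rowMean φ x n i = ∫ z, φ (x i) z ∂μ + rowMean (centerRight μ φ) x n i := by
  have hcard : ((Finset.range n).erase i).card = (n : ℝ) - 1 := by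
    rw [Finset.card_erase_of_mem (Finset.mem_range.mpr hi), Finset.card_range,
      Nat.cast_sub (by omega), Nat.cast_one]
  have hn_sub := natCast_sub_one_ne_zero hn
  simp only [rowMean, sum_range_offDiag, centerRight, Finset.sum_sub_distrib, Finset.sum_const,
    nsmul_eq_mul, hcard]
  field_simp
  ring

lemma offDiagMean_eq_add_centerRight (μ : Measure 𝓧) (φ : 𝓧 → 𝓧 → ℝ) (x : ℕ → 𝓧) {n : ℕ}
    (hn : 2 ≤ n) :
    offDiagMean φ x n = (∑ i ∈ Finset.range n, ∫ z, φ (x i) z ∂μ) / n +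
      offDiagMean (centerRight μ φ) x n := by
  rw [offDiagMean, offDiagMean, ← add_div, ← Finset.sum_add_distrib]
  congr 1
  exact Finset.sum_congr rfl fun i hi =>
    rowMean_eq_add_centerRight μ φ x hn (Finset.mem_range.mp hi)

end OffDiagonal

section UStatistic

lemma isBigO_div_natCast_sub_one {S r : ℕ → ℝ} (h : S =O[atTop] fun n => n * r n) :
    (fun n => S n / (n - 1)) =O[atTop] r := by
  refine IsBigO.trans (IsBigO.of_bound 2 ?_) (isBigO_div_natCast h)
  filter_upwards [eventually_ge_atTop 2] with n hn
  have hn' : (2 : ℝ) ≤ n := mod_cast hn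
  rw [norm_div, norm_div, Real.norm_of_nonneg (by linarith : (0 : ℝ) ≤ n - 1),
    Real.norm_of_nonneg n.cast_nonneg, ← mul_div_assoc,
    div_le_div_iff₀ (by linarith) (by linarith)]
  nlinarith [norm_nonneg (S n)]

lemma natCast_mul_sqrt (n : ℕ) : n * √n = n * (n * (√n)⁻¹) := by
  rw [← div_eq_mul_inv, Real.div_sqrt]

namespace IsIID

variable {Ω 𝓧 : Type*} [MeasurableSpace Ω] [MeasurableSpace 𝓧] {P : Measure Ω} {μ : Measure 𝓧}
  {X : ℕ → Ω → 𝓧} {φ : 𝓧 → 𝓧 → ℝ}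

lemma memLp_offDiag (hX : IsIID X μ P) (hφ : IsRightDegenerate μ φ) (i j : ℕ) :
    MemLp (fun ω => offDiag φ (X · ω) i j) 2 P := by
  by_cases hij : i = j
  · simp only [offDiag, if_pos hij]
    exact MemLp.zero
  · simp only [offDiag, if_neg hij]
    exact hφ.memLp.comp_measurePreserving (hX.measurePreserving_prodMk hij)

lemma integral_offDiag_mul_offDiag (hX : IsIID X μ P) (hφ : IsRightDegenerate μ φ)
    {i j a b : ℕ} (hja : j ≠ a) (hjb : j ≠ b) :
    ∫ ω, offDiag φ (X · ω) i j * offDiag φ (X · ω) a b ∂P = 0 := by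
  have := hX.isProbabilityMeasure
  have := hX.isProbabilityMeasure_law
  by_cases hij : i = j
  · simp only [offDiag, if_pos hij, zero_mul, integral_zero]
  let S : Finset ℕ := {i, a, b}
  let sa : S := ⟨a, by simp [S]⟩
  let sb : S := ⟨b, by simp [S]⟩
  have hmeas := fun i => (hX.measurePreserving i).measurable
  have hoffDiag : Measurable fun x : S → 𝓧 => if a = b then 0 else φ (x sa) (x sb) := by
    split_ifs
    · exact measurable_const
    · exact hφ.measurable.comp (f := fun x : S → 𝓧 => (x sa, x sb)) (by fun_prop)
  have hindep : IndepFun (fun ω => (X i ω, offDiag φ (X · ω) a b)) (X j) P :=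
    (hX.iIndepFun.indepFun_finset S {j} (by simp [S, Ne.symm hij, hja, hjb]) hmeas).comp
      ((measurable_pi_apply (⟨i, by simp [S]⟩ : S)).prodMk hoffDiag)
      (measurable_pi_apply (⟨j, by simp⟩ : ({j} : Finset ℕ)))
  have hint := (hX.memLp_offDiag hφ i j).integrable_mul (hX.memLp_offDiag hφ a b)
  simp only [Pi.mul_def, offDiag, if_neg hij] at hint ⊢
  exact hφ.integral_mul_eq_zero (hX.measurePreserving i) (hX.measurePreserving j)
    (hoffDiag.comp (measurable_pi_lambda _ fun s : S => hmeas s)) hindep hint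

lemma integral_sq_offDiag_le (hX : IsIID X μ P) (hφ : IsRightDegenerate μ φ) (i j : ℕ) :
    ∫ ω, offDiag φ (X · ω) i j ^ 2 ∂P ≤ ∫ p, Function.uncurry φ p ^ 2 ∂(μ.prod μ) := by
  by_cases hij : i = j
  · simp only [offDiag, if_pos hij]
    simpa using integral_nonneg fun p => sq_nonneg (Function.uncurry φ p)
  · have hpair := hX.measurePreserving_prodMk hij
    simp only [offDiag, if_neg hij]
    rw [← hpair.map_eq, integral_map hpair.aemeasurable
      (hφ.measurable.pow_const 2).aestronglyMeasurable]
    rfl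

/-- The orthogonal decomposition behind the bound is along the rows: for fixed `i` the variables
`φ (X i, X j)`, `j ≠ i`, are orthogonal. -/
lemma ae_isBigO_sum_sq_sum_offDiag (hX : IsIID X μ P) (hφ : IsRightDegenerate μ φ) :
    ∀ᵐ ω ∂P, (fun n => ∑ i ∈ Finset.range n,
      (∑ j ∈ Finset.range n, offDiag φ (X · ω) i j) ^ 2) =O[atTop]
        fun n : ℕ => (n : ℝ) ^ 2 * √n := by
  set c := ∫ p, Function.uncurry φ p ^ 2 ∂(μ.prod μ)
  have hmem := hX.memLp_offDiag hφ
  have hint : ∀ (k : ℕ) i, Integrable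
      (fun ω => (k + 1) * dyadicEnergy k (offDiag φ (X · ω) i)) P := fun k i =>
    (integrable_dyadicEnergy (hmem i) k).const_mul _
  have horth : ∀ i, Pairwise fun j j' =>
      ∫ ω, offDiag φ (X · ω) i j * offDiag φ (X · ω) i j' ∂P = 0 := fun i j j' hj => by
    by_cases hij : i = j
    · simp only [offDiag, if_pos hij, zero_mul, integral_zero]
    · exact hX.integral_offDiag_mul_offDiag hφ (Ne.symm hij) hj
  refine ae_isBigO_sq_mul_sqrt_of_integral_le (c := c)
    (fun k => integrable_finsetSum (Finset.range (2 ^ k)) fun i _ => hint k i)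
    (fun k n hn ω => ?_) fun k => ?_
  · rw [abs_of_nonneg (Finset.sum_nonneg fun i _ => sq_nonneg _)]
    refine (Finset.sum_le_sum fun i _ => sq_sum_range_le_dyadicEnergy _ hn).trans
      (Finset.sum_le_sum_of_subset_of_nonneg (Finset.range_mono hn) fun i _ _ => ?_)
    exact mul_nonneg (by positivity) (dyadicEnergy_nonneg k _)
  · calc ∫ ω, ∑ i ∈ Finset.range (2 ^ k), (k + 1) * dyadicEnergy k (offDiag φ (X · ω) i) ∂P
        = ∑ i ∈ Finset.range (2 ^ k),
            (k + 1) * ∫ ω, dyadicEnergy k (offDiag φ (X · ω) i) ∂P := by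
          rw [integral_finsetSum _ fun i _ => hint k i]
          simp only [integral_const_mul]
      _ ≤ ∑ _i ∈ Finset.range (2 ^ k), (k + 1) * ((k + 1) * ∑ _j ∈ Finset.range (2 ^ k), c) := by
          gcongr with i
          refine (integral_dyadicEnergy_le (hmem i) (horth i) k).trans ?_
          gcongr with j
          exact hX.integral_sq_offDiag_le hφ i j
      _ = (k + 1) ^ 2 * (2 ^ k) ^ 2 * c := by
          simp only [Finset.sum_const, Finset.card_range, nsmul_eq_mul]
          push_cast
          ring

lemma integral_sum_offDiag_mul_sum_offDiag (hX : IsIID X μ P) (hφ : IsRightDegenerate μ φ) :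
    Pairwise fun j j' => ∫ ω, (∑ i ∈ Finset.range j, offDiag φ (X · ω) i j) *
      ∑ i ∈ Finset.range j', offDiag φ (X · ω) i j' ∂P = 0 := by
  have hlt : ∀ j j', j' < j → ∫ ω, (∑ i ∈ Finset.range j, offDiag φ (X · ω) i j) *
      ∑ i ∈ Finset.range j', offDiag φ (X · ω) i j' ∂P = 0 := fun j j' hjj' => by
    have hint : ∀ i a, Integrable
        (fun ω => offDiag φ (X · ω) i j * offDiag φ (X · ω) a j') P := fun i a =>
      (hX.memLp_offDiag hφ i j).integrable_mul (hX.memLp_offDiag hφ a j')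
    simp only [Finset.sum_mul_sum]
    rw [integral_finsetSum _ fun i _ => integrable_finsetSum _ fun a _ => hint i a]
    refine Finset.sum_eq_zero fun i _ => ?_
    rw [integral_finsetSum _ fun a _ => hint i a]
    refine Finset.sum_eq_zero fun a ha => hX.integral_offDiag_mul_offDiag hφ ?_ hjj'.ne'
    exact ((Finset.mem_range.mp ha).trans hjj').ne'
  intro j j' hjj'
  rcases hjj'.lt_or_gt with h | h
  · simpa only [mul_comm] using hlt j' j h
  · exact hlt j j' h

lemma integral_sq_sum_offDiag_le (hX : IsIID X μ P) (hφ : IsRightDegenerate μ φ)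
    (hφ_flip : IsRightDegenerate μ (flip φ)) (j n : ℕ) :
    ∫ ω, (∑ i ∈ Finset.range n, offDiag φ (X · ω) i j) ^ 2 ∂P ≤
      n * ∫ p, Function.uncurry φ p ^ 2 ∂(μ.prod μ) := by
  have horth : Pairwise fun i i' =>
      ∫ ω, offDiag φ (X · ω) i j * offDiag φ (X · ω) i' j ∂P = 0 := fun i i' hi => by
    by_cases hij : i = j
    · simp only [offDiag, if_pos hij, zero_mul, integral_zero]
    · simpa only [offDiag_flip] using
        hX.integral_offDiag_mul_offDiag hφ_flip (i := j) (a := j) hij hi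
  rw [integral_sq_sum_of_orthogonal (fun i => hX.memLp_offDiag hφ i j) horth]
  refine (Finset.sum_le_card_nsmul _ _ _ fun i _ => hX.integral_sq_offDiag_le hφ i j).trans_eq ?_
  rw [Finset.card_range, nsmul_eq_mul]

lemma ae_isBigO_sum_sum_offDiag (hX : IsIID X μ P) (hφ : IsRightDegenerate μ φ)
    (hφ_flip : IsRightDegenerate μ (flip φ)) :
    ∀ᵐ ω ∂P, (fun n => ∑ j ∈ Finset.range n, ∑ i ∈ Finset.range j, offDiag φ (X · ω) i j)
      =O[atTop] fun n : ℕ => n * √n := by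
  set c := ∫ p, Function.uncurry φ p ^ 2 ∂(μ.prod μ)
  have : 0 ≤ c := integral_nonneg fun p => sq_nonneg _
  have hmem : ∀ j, MemLp (fun ω => ∑ i ∈ Finset.range j, offDiag φ (X · ω) i j) 2 P := fun j =>
    memLp_finsetSum _ fun i _ => hX.memLp_offDiag hφ i j
  have hsq : ∀ᵐ ω ∂P, (fun n => (∑ j ∈ Finset.range n,
      ∑ i ∈ Finset.range j, offDiag φ (X · ω) i j) ^ 2) =O[atTop]
        fun n : ℕ => (n : ℝ) ^ 2 * √n := by
    refine ae_isBigO_sq_mul_sqrt_of_integral_le (c := c)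
      (fun k => (integrable_dyadicEnergy hmem k).const_mul (k + 1)) (fun k n hn ω => ?_)
      fun k => ?_
    · rw [abs_of_nonneg (sq_nonneg _)]
      exact sq_sum_range_le_dyadicEnergy _ hn
    · rw [integral_const_mul]
      calc (k + 1) * ∫ ω, dyadicEnergy k
              (fun j => ∑ i ∈ Finset.range j, offDiag φ (X · ω) i j) ∂P
          ≤ (k + 1) * ((k + 1) * ∑ _j ∈ Finset.range (2 ^ k), 2 ^ k * c) := by
            gcongr
            refine (integral_dyadicEnergy_le hmem
              (hX.integral_sum_offDiag_mul_sum_offDiag hφ) k).trans ?_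
            gcongr with j hj
            refine (hX.integral_sq_sum_offDiag_le hφ hφ_flip j j).trans ?_
            gcongr
            exact_mod_cast (Finset.mem_range.mp hj).le
        _ = (k + 1) ^ 2 * (2 ^ k) ^ 2 * c := by
            simp only [Finset.sum_const, Finset.card_range, nsmul_eq_mul]
            push_cast
            ring
  filter_upwards [hsq] with ω hω
  refine IsBigO.of_pow two_ne_zero (hω.trans (IsBigO.of_bound' ?_))
  filter_upwards [eventually_ge_atTop 1] with n hn
  have hn' : (1 : ℝ) ≤ n := mod_cast hn
  rw [Pi.pow_apply, mul_pow, Real.sq_sqrt n.cast_nonneg, Real.norm_of_nonneg (by positivity),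
    Real.norm_of_nonneg (by positivity)]
  gcongr
  exact Real.sqrt_le_self_iff.mpr (Or.inr hn')

lemma ae_isBigO_offDiagMean_of_flip (hX : IsIID X μ P) (hφ : IsRightDegenerate μ φ)
    (hφ_flip : IsRightDegenerate μ (flip φ)) :
    ∀ᵐ ω ∂P, offDiagMean φ (X · ω) =O[atTop] lilRate := by
  filter_upwards [hX.ae_isBigO_sum_sum_offDiag hφ hφ_flip,
    hX.ae_isBigO_sum_sum_offDiag hφ_flip hφ] with ω hω hω_flip
  have hsum : (fun n => ∑ i ∈ Finset.range n, ∑ j ∈ Finset.range n, offDiag φ (X · ω) i j)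
      =O[atTop] fun n : ℕ => n * (n * (√n)⁻¹) := by
    simpa only [sum_sum_offDiag, natCast_mul_sqrt] using hω.add hω_flip
  refine IsBigO.trans ?_ isBigO_inv_sqrt_lilRate
  simpa only [← offDiagMean_eq_sum_div] using
    isBigO_div_natCast (isBigO_div_natCast_sub_one hsum)

lemma ae_isBigO_offDiagMean_sub_of_centerRight (hX : IsIID X μ P)
    (hφ : Measurable (Function.uncurry φ)) (hL2 : MemLp (Function.uncurry φ) 2 (μ.prod μ))
    (hcenter : ∀ᵐ ω ∂P, offDiagMean (centerRight μ φ) (X · ω) =O[atTop] lilRate) :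
    ∀ᵐ ω ∂P, (fun n => offDiagMean φ (X · ω) n - ∫ p, Function.uncurry φ p ∂(μ.prod μ))
      =O[atTop] lilRate := by
  have := hX.isProbabilityMeasure_law
  filter_upwards [hcenter, hX.ae_isBigO_sum_div_sub (measurable_integral_right hφ)
    (memLp_integral_right one_le_two ENNReal.ofNat_ne_top hφ hL2)] with ω hω hmean
  refine (hmean.add hω).congr' ?_ EventuallyEq.rfl
  filter_upwards [eventually_ge_atTop 2] with n hn
  rw [integral_prod _ (hL2.integrable one_le_two), offDiagMean_eq_add_centerRight μ φ _ hn]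
  exact sub_add_eq_add_sub _ _ _

lemma ae_isBigO_offDiagMean_of_isRightDegenerate (hX : IsIID X μ P)
    (hφ : IsRightDegenerate μ φ) : ∀ᵐ ω ∂P, offDiagMean φ (X · ω) =O[atTop] lilRate := by
  have := hX.isProbabilityMeasure_law
  have hflip : Measurable (Function.uncurry (flip φ)) := hφ.measurable.comp measurable_swap
  have hzero : ∫ p, Function.uncurry (flip φ) p ∂(μ.prod μ) = 0 :=
    (integral_prod_swap _).trans hφ.integral_eq_zero
  simpa only [hzero, sub_zero, offDiagMean_flip] using
    hX.ae_isBigO_offDiagMean_sub_of_centerRight hflip (memLp_flip hφ.memLp)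
      (hX.ae_isBigO_offDiagMean_of_flip
        (isRightDegenerate_centerRight hflip (memLp_flip hφ.memLp)) hφ.flip_centerRight_flip)

/-- The two projections of Hoeffding's decomposition are removed one after the other, by centring
the kernel in its second argument and then, after flipping, in the other one. -/
theorem ae_isBigO_offDiagMean_sub (hX : IsIID X μ P) (hφ : Measurable (Function.uncurry φ))
    (hL2 : MemLp (Function.uncurry φ) 2 (μ.prod μ)) :
    ∀ᵐ ω ∂P, (fun n => offDiagMean φ (X · ω) n - ∫ p, Function.uncurry φ p ∂(μ.prod μ))
      =O[atTop] lilRate := by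
  have := hX.isProbabilityMeasure_law
  exact hX.ae_isBigO_offDiagMean_sub_of_centerRight hφ hL2
    (hX.ae_isBigO_offDiagMean_of_isRightDegenerate (isRightDegenerate_centerRight hφ hL2))

lemma ae_isBigO_sum_sq_rowMean_div (hX : IsIID X μ P) (hφ : IsRightDegenerate μ φ) :
    ∀ᵐ ω ∂P, (fun n => (∑ i ∈ Finset.range n, rowMean φ (X · ω) n i ^ 2) / n) =O[atTop]
      lilRate := by
  filter_upwards [hX.ae_isBigO_sum_sq_sum_offDiag hφ] with ω hω
  have hsum : (fun n => ∑ i ∈ Finset.range n, (∑ j ∈ Finset.range n, offDiag φ (X · ω) i j) ^ 2)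
      =O[atTop] fun n : ℕ => n * (n * (n * (√n)⁻¹)) := by
    simpa only [sq, mul_assoc, natCast_mul_sqrt] using hω
  refine IsBigO.trans ?_ isBigO_inv_sqrt_lilRate
  simp only [rowMean, div_pow, ← Finset.sum_div]
  simpa only [sq, div_div] using
    isBigO_div_natCast (isBigO_div_natCast_sub_one (isBigO_div_natCast_sub_one hsum))

end IsIID

end UStatistic

section Jackknife

section Deterministic

variable {𝓧 : Type*}

lemma uStat_eq_offDiagMean {h : 𝓧 → 𝓧 → ℝ} (hsymm : ∀ y z, h y z = h z y) (x : ℕ → 𝓧) (n : ℕ) :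
    uStat h x n = offDiagMean h x n := by
  have hflip : flip h = h := funext₂ fun y z => hsymm z y
  have hlt : ∀ j, ∑ i ∈ Finset.range j, offDiag h x i j = ∑ i ∈ Finset.range j, h (x i) (x j) :=
    fun j => Finset.sum_congr rfl fun i hi => if_neg (Finset.mem_range.mp hi).ne
  rw [uStat, offDiagMean_eq_sum_div, sum_sum_offDiag, hflip, ← two_mul, Nat.cast_choose_two]
  simp only [hlt, div_eq_mul_inv, mul_inv, inv_inv]
  ring

lemma jackknifeVar_eq {h : 𝓧 → 𝓧 → ℝ} (hsymm : ∀ y z, h y z = h z y) (x : ℕ → 𝓧) (n : ℕ) :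
    jackknifeVar h x n =
      (∑ i ∈ Finset.range n, rowMean h x n i ^ 2) / n - offDiagMean h x n ^ 2 := by
  simp only [jackknifeVar, uStat_eq_offDiagMean hsymm, rowMean, sum_range_offDiag,
    one_div_mul_eq_div]

lemma sum_sq_rowMean_div_eq [MeasurableSpace 𝓧] (μ : Measure 𝓧) (φ : 𝓧 → 𝓧 → ℝ) (x : ℕ → 𝓧)
    {n : ℕ} (hn : 2 ≤ n) :
    (∑ i ∈ Finset.range n, rowMean φ x n i ^ 2) / n =
      (∑ i ∈ Finset.range n, (∫ z, φ (x i) z ∂μ) ^ 2) / n +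
        2 * offDiagMean (fun y z => (∫ w, φ y w ∂μ) * centerRight μ φ y z) x n +
        (∑ i ∈ Finset.range n, rowMean (centerRight μ φ) x n i ^ 2) / n := by
  simp only [offDiagMean, rowMean_mul_left]
  rw [← mul_div_assoc, ← add_div, ← add_div, Finset.mul_sum, ← Finset.sum_add_distrib,
    ← Finset.sum_add_distrib]
  congr 1
  refine Finset.sum_congr rfl fun i hi => ?_
  rw [rowMean_eq_add_centerRight μ φ x hn (Finset.mem_range.mp hi)]
  ring

end Deterministic

lemma holderTriple_four_four_two : ENNReal.HolderTriple 4 4 2 :=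
  ⟨by rw [← two_mul, show (4 : ENNReal) = 2 * 2 by norm_num, ENNReal.mul_inv (by simp) (by simp),
    ← mul_assoc, ENNReal.mul_inv_cancel (by simp) (by simp), one_mul]⟩

section Kernels

variable {𝓧 : Type*} [MeasurableSpace 𝓧] {μ : Measure 𝓧} [IsProbabilityMeasure μ]
  {φ : 𝓧 → 𝓧 → ℝ}

lemma memLp_sq_integral_right (hφ : Measurable (Function.uncurry φ))
    (hL4 : MemLp (Function.uncurry φ) 4 (μ.prod μ)) :
    MemLp (fun x => (∫ y, φ x y ∂μ) ^ 2) 2 μ := by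
  have := holderTriple_four_four_two
  have hL := memLp_integral_right (by norm_num) ENNReal.ofNat_ne_top hφ hL4
  simp only [sq]
  exact hL.mul hL

lemma isRightDegenerate_integral_mul_centerRight (hφ : Measurable (Function.uncurry φ))
    (hL4 : MemLp (Function.uncurry φ) 4 (μ.prod μ)) :
    IsRightDegenerate μ (fun x y => (∫ z, φ x z ∂μ) * centerRight μ φ x y) where
  measurable := ((measurable_integral_right hφ).comp measurable_fst).mul (measurable_centerRight hφ)
  memLp := by
    have := holderTriple_four_four_two
    exact (memLp_centerRight (by norm_num) ENNReal.ofNat_ne_top hφ hL4).mul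
      ((memLp_integral_right (by norm_num) ENNReal.ofNat_ne_top hφ hL4).comp_measurePreserving
        measurePreserving_fst)
  ae_integral_eq_zero := by
    have hL2 := hL4.mono_exponent (by norm_num : (2 : ENNReal) ≤ 4)
    filter_upwards [(isRightDegenerate_centerRight hφ hL2).ae_integral_eq_zero] with x hx
    rw [integral_const_mul, hx, mul_zero]

end Kernels

namespace IsIID

variable {Ω 𝓧 : Type*} [MeasurableSpace Ω] [MeasurableSpace 𝓧] {P : Measure Ω} {μ : Measure 𝓧}
  {X : ℕ → Ω → 𝓧} {φ h : 𝓧 → 𝓧 → ℝ}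

lemma ae_isBigO_sum_sq_rowMean_div_sub (hX : IsIID X μ P) (hφ : Measurable (Function.uncurry φ))
    (hL4 : MemLp (Function.uncurry φ) 4 (μ.prod μ)) :
    ∀ᵐ ω ∂P, (fun n => (∑ i ∈ Finset.range n, rowMean φ (X · ω) n i ^ 2) / n -
      ∫ x, (∫ y, φ x y ∂μ) ^ 2 ∂μ) =O[atTop] lilRate := by
  have := hX.isProbabilityMeasure_law
  have hL2 := hL4.mono_exponent (by norm_num : (2 : ENNReal) ≤ 4)
  filter_upwards [
    hX.ae_isBigO_sum_div_sub ((measurable_integral_right hφ).pow_const 2)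
      (memLp_sq_integral_right hφ hL4),
    hX.ae_isBigO_offDiagMean_of_isRightDegenerate
      (isRightDegenerate_integral_mul_centerRight hφ hL4),
    hX.ae_isBigO_sum_sq_rowMean_div (isRightDegenerate_centerRight hφ hL2)]
    with ω hmean hcross hsq
  refine ((hmean.add (hcross.const_mul_left 2)).add hsq).congr' ?_ EventuallyEq.rfl
  filter_upwards [eventually_ge_atTop 2] with n hn
  rw [sum_sq_rowMean_div_eq μ φ _ hn]
  ring

lemma ae_isBigO_sq_offDiagMean_sub (hX : IsIID X μ P) (hφ : Measurable (Function.uncurry φ))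
    (hL2 : MemLp (Function.uncurry φ) 2 (μ.prod μ)) :
    ∀ᵐ ω ∂P, (fun n => offDiagMean φ (X · ω) n ^ 2 -
      (∫ p, Function.uncurry φ p ∂(μ.prod μ)) ^ 2) =O[atTop] lilRate := by
  filter_upwards [hX.ae_isBigO_offDiagMean_sub hφ hL2] with ω hω
  have hbdd := (tendsto_sub_nhds_zero_iff.mp (hω.trans_tendsto tendsto_lilRate)).add_const
    (∫ p, Function.uncurry φ p ∂(μ.prod μ))
  simpa only [sq_sub_sq, one_mul] using (hbdd.isBigO_one ℝ).mul hω

lemma sigmaSq_eq (hX : IsIID X μ P) (hh : Measurable (Function.uncurry h))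
    (hL2 : MemLp (Function.uncurry h) 2 (μ.prod μ)) :
    sigmaSq P X h =
      ∫ x, (∫ y, h x y ∂μ) ^ 2 ∂μ - (∫ p, Function.uncurry h p ∂(μ.prod μ)) ^ 2 := by
  have := hX.isProbabilityMeasure_law
  have hproj := memLp_integral_right one_le_two ENNReal.ofNat_ne_top hh hL2
  have hfirst : ∀ x, firstProj P X h x = ∫ y, h x y ∂μ - theta P X h := fun x => by
    have hx : Measurable (h x) := hh.comp measurable_prodMk_left
    rw [firstProj, hX.integral_comp hx.aestronglyMeasurable]
  calc sigmaSq P X h = Var[fun ω => firstProj P X h (X 0 ω); P] := rfl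
    _ = Var[fun x => ∫ y, h x y ∂μ - theta P X h; μ] := by
        simp only [hfirst]
        exact (hX.measurePreserving 0).variance_fun_comp (hproj.1.aemeasurable.sub_const _)
    _ = Var[fun x => ∫ y, h x y ∂μ; μ] := variance_sub_const hproj.1 _
    _ = ∫ x, (∫ y, h x y ∂μ) ^ 2 ∂μ - (∫ p, Function.uncurry h p ∂(μ.prod μ)) ^ 2 := by
        rw [variance_eq_sub hproj, integral_prod _ (hL2.integrable one_le_two)]
        rfl

lemma memLp_four_of_integrable (hX : IsIID X μ P) (hh : Measurable (Function.uncurry h))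
    (hmom : Integrable (fun ω => |h (X 0 ω) (X 1 ω)| ^ 4) P) :
    MemLp (Function.uncurry h) 4 (μ.prod μ) := by
  have hpair := hX.measurePreserving_prodMk zero_ne_one
  have hfour : (4 : ENNReal).toReal = ((4 : ℕ) : ℝ) := by simp
  rw [← hpair.map_eq, memLp_map_measure_iff hh.aestronglyMeasurable hpair.aemeasurable,
    ← integrable_norm_rpow_iff (hh.comp hpair.measurable).aestronglyMeasurable four_ne_zero
      ENNReal.ofNat_ne_top]
  simp only [hfour, Real.rpow_natCast]
  exact hmom

lemma ae_isBigO_jackknifeVar_sub (hX : IsIID X μ P) (hh : Measurable (Function.uncurry h))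
    (hsymm : ∀ x y, h x y = h y x) (hL4 : MemLp (Function.uncurry h) 4 (μ.prod μ)) :
    ∀ᵐ ω ∂P, (fun n => jackknifeVar h (X · ω) n - sigmaSq P X h) =O[atTop] lilRate := by
  have := hX.isProbabilityMeasure_law
  have hL2 := hL4.mono_exponent (by norm_num : (2 : ENNReal) ≤ 4)
  filter_upwards [hX.ae_isBigO_sum_sq_rowMean_div_sub hh hL4,
    hX.ae_isBigO_sq_offDiagMean_sub hh hL2] with ω hrow hmean
  simpa only [jackknifeVar_eq hsymm, hX.sigmaSq_eq hh hL2, sub_sub_sub_comm] using hrow.sub hmean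

end IsIID

end Jackknife

end JackknifeU

end

theorem theorem2 {Ω 𝓧 : Type*} [MeasurableSpace Ω] [MeasurableSpace 𝓧]
    (P : Measure Ω) [IsProbabilityMeasure P]
    (X : ℕ → Ω → 𝓧) (hX : ∀ i, Measurable (X i))
    (hindep : iIndepFun X P) (hident : ∀ i, IdentDistrib (X i) (X 0) P P)
    (h : 𝓧 → 𝓧 → ℝ) (hmeas : Measurable (Function.uncurry h))
    (hsymm : ∀ x y, h x y = h y x)
    (hmom : Integrable (fun ω => |h (X 0 ω) (X 1 ω)| ^ 4) P) :
    (∀ᵐ ω ∂P, Tendsto (fun n : ℕ => JackknifeU.jackknifeVar h (fun i => X i ω) n)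
      atTop (𝓝 (JackknifeU.sigmaSq P X h))) ∧
    (∀ᵐ ω ∂P,
      (fun n : ℕ => |JackknifeU.jackknifeVar h (fun i => X i ω) n - JackknifeU.sigmaSq P X h|)
        =O[atTop] (fun n : ℕ => Real.sqrt (Real.log (Real.log (n : ℝ)) / (n : ℝ)))) := by
  have hiid : JackknifeU.IsIID X (P.map (X 0)) P := ⟨hindep, fun i => ⟨hX i, (hident i).map_eq⟩⟩
  have hrate := hiid.ae_isBigO_jackknifeVar_sub hmeas hsymm
    (hiid.memLp_four_of_integrable hmeas hmom)
  refine ⟨?_, ?_⟩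
  · filter_upwards [hrate] with ω hω
    exact tendsto_sub_nhds_zero_iff.mp (hω.trans_tendsto JackknifeU.tendsto_lilRate)
  · filter_upwards [hrate] with ω hω
    exact hω.abs_left
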